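/- Let $G$ be a finite group, let $k$ be an algebraically closed field whose characteristic does not divide $|G|$ (characteristic $0$ is allowed), let $kG$ be the group algebra, let $c\in kG$, and let $S(c,kG)=\{r\in kG\mid cr=rc\}$ be the centralizer of $c$. Then the following hold. (1) The $k$-algebra $S:=S(c,kG)$ is cellular in the sense of Graham and Lehrer: there are a finite partially ordered set $P$, a finite set $M(p)$ for each $p\in P$, a $k$-basis $\{C^p_{ij}\mid p\in P,\ i,j\in M(p)\}$ of $S$, and a $k$-linear map $\iota:S\to S$ with $\iota(ab)=\iota(b)\iota(a)$, $\iota^2=\mathrm{id}$ and $\iota(C^p_{ij})=C^p_{ji}$, such that for all $a\in S$, $p\in P$, $i,j\in M(p)$, $$aC^p_{ij}=\sum_{u\in M(p)}r_a(u,i)\,C^p_{uj}+r',$$ where $r_a(u,i)\in k$ does not depend on $j$ and $r'$ is a $k$-linear combination of basis elements $C^q_{st}$ with $q<p$. (2) The extension of rings $S\subseteq A:=kG$ is a Frobenius extension: $A$ is a finitely generated projective left $S$-module, and $\mathrm{Hom}_S({}_SA,{}_SS)\simeq A$ as $A$-$S$-bimodules, where $(af)(y)=f(ya)$ and $(fs)(y)=f(y)s$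 for $f\in \mathrm{Hom}_S({}_SA,{}_SS)$, $a,y\in A$, $s\in S$. (3) The extension $S\subseteq A$ is separable: the multiplication map $A\otimes_SA\to A$, $x\otimes y\mapsto xy$, is a split surjective homomorphism of $A$-$A$-bimodules. -/

import Mathlib

/-! ### Cellular algebras -/

/-- A cell datum `(P, M, C, ι)`, in the sense of Graham and Lehrer, for a unitary algebra `A` over a
commutative ring `R`. As `P` and all the `M p` are finite, taking them in `Type` loses nothing. -/
structure CellDatum (R A : Type*) [CommRing R] [Ring A] [Algebra R A] where
  /-- The finite partially ordered set of cells. -/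
  P : Type
  [instPartialOrder : PartialOrder P]
  [instFiniteP : Finite P]
  /-- The finite index set attached to a cell. -/
  M : P → Type
  [instFintypeM : ∀ p, Fintype (M p)]
  /-- The `R`-basis `C p i j`, where `p` lies in `P` and `i`, `j` lie in `M p`. -/
  C : Module.Basis (Σ p, M p × M p) R A
  /-- The involution: an `R`-linear anti-automorphism of `A` whose square is the identity. -/
  ι : A →ₗ[R] A
  ι_mul : ∀ a b, ι (a * b) = ι b * ι a
  ι_ι : ∀ a, ι (ι a) = a
  ι_C : ∀ p (i j : M p), ι (C ⟨p, i, j⟩) = C ⟨p, j, i⟩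
  /-- The coefficient `r a p u i` is not allowed to depend on the second index `j`. -/
  r : A → ∀ p, M p → M p → R
  mul_C : ∀ (a : A) (p : P) (i j : M p),
    a * C ⟨p, i, j⟩ - ∑ u, r a p u i • C ⟨p, u, j⟩ ∈
      Submodule.span R {x | ∃ q, q < p ∧ ∃ s t : M q, x = C ⟨q, s, t⟩}

/-- The `R`-algebra `A` is cellular: it has a cell datum. -/
def IsCellularAlgebra (R A : Type*) [CommRing R] [Ring A] [Algebra R A] : Prop :=
  Nonempty (CellDatum R A)

/-! ### Frobenius extensions and separable extensions -/

namespace RingExtension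

variable {A : Type*} [Ring A] (B : Subring A)

/-- The extension `B ⊆ A` is a Frobenius extension: `A` is finitely generated projective as a left
`B`-module, and `A` is isomorphic to `Hom_B(A, B)` as an `A`-`B`-bimodule, where `Hom_B(A, B)`
consists of the homomorphisms of left `B`-modules, with the `A`-`B`-bimodule structure
`(a f)(y) = f (y a)` and `(f b)(y) = f(y) b`. -/
def IsFrobenius : Prop :=
  Module.Finite B A ∧ Module.Projective B A ∧
    ∃ Φ : A ≃+ (A →ₗ[B] B),
      (∀ a x y : A, Φ (a * x) y = Φ x (y * a)) ∧
      (∀ (x : A) (b : B) (y : A), Φ (x * b) y = Φ x y * b)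

/-- The relations of the tensor product `A ⊗_B A`, as a set of elements of the free abelian group
on `A × A`: additivity in each variable, and `(x b, y) = (x, b y)` for `b` in `B`. -/
inductive TensorRel : FreeAbelianGroup (A × A) → Prop
  | add_left (x x' y : A) : TensorRel
      (FreeAbelianGroup.of (x + x', y) - (FreeAbelianGroup.of (x, y) + FreeAbelianGroup.of (x', y)))
  | add_right (x y y' : A) : TensorRel
      (FreeAbelianGroup.of (x, y + y') - (FreeAbelianGroup.of (x, y) + FreeAbelianGroup.of (x, y')))
  | balanced (x : A) (b : B) (y : A) : TensorRel
      (FreeAbelianGroup.of (x * (b : A), y) - FreeAbelianGroup.of (x, (b : A) * y))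

/-- The subgroup generated by the relations of `A ⊗_B A`. -/
def tensorKer : AddSubgroup (FreeAbelianGroup (A × A)) :=
  AddSubgroup.closure {t | TensorRel B t}

/-- The tensor product `A ⊗_B A` over the (possibly noncommutative) subring `B`, as an abelian
group: the free abelian group on `A × A` modulo the relations above. -/
abbrev BalancedTensor : Type _ := FreeAbelianGroup (A × A) ⧸ tensorKer B

/-- The elementary tensor `x ⊗ y` in `A ⊗_B A`. -/
def btmul (x y : A) : BalancedTensor B :=
  QuotientAddGroup.mk' (tensorKer B) (FreeAbelianGroup.of (x, y))

theorem btmul_add_left (x x' y : A) : btmul B (x + x') y = btmul B x y + btmul B x' y := by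
  rw [btmul, btmul, btmul, ← map_add, ← sub_eq_zero, ← map_sub]
  exact (QuotientAddGroup.eq_zero_iff _).2 (AddSubgroup.subset_closure (.add_left x x' y))

theorem btmul_add_right (x y y' : A) : btmul B x (y + y') = btmul B x y + btmul B x y' := by
  rw [btmul, btmul, btmul, ← map_add, ← sub_eq_zero, ← map_sub]
  exact (QuotientAddGroup.eq_zero_iff _).2 (AddSubgroup.subset_closure (.add_right x y y'))

theorem btmul_balanced (x : A) (b : B) (y : A) :
    btmul B (x * (b : A)) y = btmul B x ((b : A) * y) := by
  rw [btmul, btmul, ← sub_eq_zero, ← map_sub]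
  exact (QuotientAddGroup.eq_zero_iff _).2 (AddSubgroup.subset_closure (.balanced x b y))

/-- The universal property of `A ⊗_B A`: a biadditive `B`-balanced map `f` induces a homomorphism
with `x ⊗ y ↦ f x y`. -/
def tensorLift {N : Type*} [AddCommGroup N] (f : A → A → N)
    (hl : ∀ x x' y, f (x + x') y = f x y + f x' y)
    (hr : ∀ x y y', f x (y + y') = f x y + f x y')
    (hb : ∀ (x : A) (b : B) (y : A), f (x * (b : A)) y = f x ((b : A) * y)) :
    BalancedTensor B →+ N :=
  QuotientAddGroup.lift (tensorKer B) (FreeAbelianGroup.lift fun p => f p.1 p.2) (by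
    refine (AddSubgroup.closure_le _).2 ?_
    rintro _ (⟨x, x', y⟩ | ⟨x, y, y'⟩ | ⟨x, b, y⟩)
    · simp [AddMonoidHom.mem_ker, hl]
    · simp [AddMonoidHom.mem_ker, hr]
    · simp [AddMonoidHom.mem_ker, hb])

theorem tensorLift_btmul {N : Type*} [AddCommGroup N] (f : A → A → N) (hl hr hb) (x y : A) :
    tensorLift B f hl hr hb (btmul B x y) = f x y :=
  FreeAbelianGroup.lift_apply_of _ _

/-- The left action of `a : A` on `A ⊗_B A`: `a (x ⊗ y) = (a x) ⊗ y`. -/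
def leftMul (a : A) : BalancedTensor B →+ BalancedTensor B :=
  tensorLift B (fun x y => btmul B (a * x) y)
    (fun x x' y => by rw [mul_add, btmul_add_left])
    (fun x y y' => btmul_add_right B (a * x) y y')
    (fun x b y => by rw [← mul_assoc, btmul_balanced])

/-- The right action of `a : A` on `A ⊗_B A`: `(x ⊗ y) a = x ⊗ (y a)`. -/
def rightMul (a : A) : BalancedTensor B →+ BalancedTensor B :=
  tensorLift B (fun x y => btmul B x (y * a))
    (fun x x' y => btmul_add_left B x x' (y * a))
    (fun x y y' => by rw [add_mul, btmul_add_right])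
    (fun x b y => by rw [mul_assoc, btmul_balanced])

/-- The multiplication map `A ⊗_B A → A`, `x ⊗ y ↦ x y`. -/
def mulMap : BalancedTensor B →+ A :=
  tensorLift B (fun x y => x * y) add_mul mul_add (fun x b y => mul_assoc x b y)

/-- The extension `B ⊆ A` is separable: the multiplication map `A ⊗_B A → A` is a split surjection
of `A`-bimodules, that is, it has a section which is a homomorphism of `A`-bimodules. -/
def IsSeparable : Prop :=
  ∃ s : A →+ BalancedTensor B,
    (∀ a x : A, s (a * x) = leftMul B a (s x)) ∧
    (∀ x a : A, s (x * a) = rightMul B a (s x)) ∧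
    ∀ x : A, mulMap B (s x) = x

end RingExtension

/-! ### Separability -/

namespace RingExtension

variable {A : Type*} [Ring A] (B : Subring A)

/-! Separability holds over every subalgebra of `kG`: the element `|G|⁻¹ ∑ g ⊗ g⁻¹` multiplies to
`1` and commutes with `kG`. For the other two properties, Maschke and Wedderburn give `kG ≅ ∏
Mₙ(k)`. Centralizers, cell data and Frobenius systems are compatible with isomorphisms and finite
products, so `c` may be taken to be a single matrix.

Frobenius: let `f` be the minimal polynomial of `c`, of degree `d`, and let `L`, `R` be left and
right multiplication by `c`. The divided difference `E = (f(L) - f(R)) / (L - R)` maps into the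
centralizer `S` because `f(c) = 0`, and it is `S`-bilinear. A functional `τ` that is `1` on `c ^ (d
- 1)` and `0` on lower powers can be written `τ(a) • 1 = ∑ xⱼ a yⱼ`; then `xⱼ`, `yⱼ` are dual bases
for `E`, as `f` is monic (`nonempty_frobeniusSystem_matrix`, `FrobeniusSystem.isFrobenius`).

Cellular: let `c` be a Jordan matrix. A block of a commuting matrix is zero between different
eigenvalues and otherwise upper triangular Toeplitz, hence determined by its last column. The basis
element for blocks `i`, `j` of sizes greater than `s` has a single `1` in its last column, in row
`s`. Multiplying it by `X` replaces that column by column `s` of `X`, which vanishes below row `s`: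
row `s` gives the coefficients, the rows above give lower cells. The involution is the flip along
antidiagonals (`JordanMatrix.cellDatum`). -/

theorem leftMul_btmul (a x y : A) : leftMul B a (btmul B x y) = btmul B (a * x) y :=
  tensorLift_btmul B _ _ _ _ x y

theorem rightMul_btmul (a x y : A) : rightMul B a (btmul B x y) = btmul B x (y * a) :=
  tensorLift_btmul B _ _ _ _ x y

theorem mulMap_btmul (x y : A) : mulMap B (btmul B x y) = x * y :=
  tensorLift_btmul B _ _ _ _ x y

/-- `A ⊗_B A` is generated by the elementary tensors. -/
theorem balancedTensor_hom_ext {N : Type*} [AddCommGroup N] {f g : BalancedTensor B →+ N}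
    (h : ∀ x y, f (btmul B x y) = g (btmul B x y)) : f = g := by
  refine QuotientAddGroup.addMonoidHom_ext _ (FreeAbelianGroup.lift_ext _ _ ?_)
  rintro ⟨x, y⟩
  exact h x y

theorem leftMul_mul (a b : A) (t : BalancedTensor B) :
    leftMul B (a * b) t = leftMul B a (leftMul B b t) := by
  have : leftMul B (a * b) = (leftMul B a).comp (leftMul B b) :=
    balancedTensor_hom_ext B fun x y => by simp [leftMul_btmul, mul_assoc]
  exact DFunLike.congr_fun this t

theorem rightMul_leftMul (a b : A) (t : BalancedTensor B) :
    rightMul B a (leftMul B b t) = leftMul B b (rightMul B a t) := by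
  have : (rightMul B a).comp (leftMul B b) = (leftMul B b).comp (rightMul B a) :=
    balancedTensor_hom_ext B fun x y => by simp [leftMul_btmul, rightMul_btmul]
  exact DFunLike.congr_fun this t

theorem leftMul_add (a b : A) (t : BalancedTensor B) :
    leftMul B (a + b) t = leftMul B a t + leftMul B b t := by
  have : leftMul B (a + b) = leftMul B a + leftMul B b :=
    balancedTensor_hom_ext B fun x y => by simp [leftMul_btmul, add_mul, btmul_add_left]
  exact DFunLike.congr_fun this t

theorem rightMul_add (a b : A) (t : BalancedTensor B) :
    rightMul B (a + b) t = rightMul B a t + rightMul B b t := by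
  have : rightMul B (a + b) = rightMul B a + rightMul B b :=
    balancedTensor_hom_ext B fun x y => by simp [rightMul_btmul, mul_add, btmul_add_right]
  exact DFunLike.congr_fun this t

theorem rightMul_mul (a b : A) (t : BalancedTensor B) :
    rightMul B (a * b) t = rightMul B b (rightMul B a t) := by
  have : rightMul B (a * b) = (rightMul B b).comp (rightMul B a) :=
    balancedTensor_hom_ext B fun x y => by simp [rightMul_btmul, mul_assoc]
  exact DFunLike.congr_fun this t

theorem mulMap_leftMul (a : A) (t : BalancedTensor B) :
    mulMap B (leftMul B a t) = a * mulMap B t := by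
  have : (mulMap B).comp (leftMul B a) = (AddMonoidHom.mulLeft a).comp (mulMap B) :=
    balancedTensor_hom_ext B fun x y => by simp [leftMul_btmul, mulMap_btmul, mul_assoc]
  exact DFunLike.congr_fun this t

/-- An extension with a separability element is separable. -/
theorem IsSeparable.of_element (t : BalancedTensor B) (ht : mulMap B t = 1)
    (hc : ∀ a, leftMul B a t = rightMul B a t) : IsSeparable B := by
  refine ⟨AddMonoidHom.mk' (fun a => leftMul B a t) fun a b => leftMul_add B a b t,
    fun a x => leftMul_mul B a x t, fun x a => ?_, fun x => ?_⟩
  · change leftMul B (x * a) t = rightMul B a (leftMul B x t)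
    rw [rightMul_leftMul, leftMul_mul, hc]
  · change mulMap B (leftMul B x t) = x
    rw [mulMap_leftMul, ht, mul_one]

/-- A group algebra of a finite group of invertible order is separable over every subalgebra. -/
theorem isSeparable_monoidAlgebra {G k : Type*} [Group G] [Finite G] [Field k]
    (hG : (Nat.card G : k) ≠ 0) (S : Subalgebra k (MonoidAlgebra k G)) :
    IsSeparable S.toSubring := by
  have := Fintype.ofFinite G
  set B := S.toSubring
  let e : G → MonoidAlgebra k G := fun g => MonoidAlgebra.of k G g
  let z : k → MonoidAlgebra k G := algebraMap k _
  have hz (r : k) : z r ∈ B := S.algebraMap_mem r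
  -- The averaging element. Left multiplication by `h` is undone on the right by reindexing `g ↦ h *
  -- g`.
  refine IsSeparable.of_element B (∑ g : G, btmul B (z (Nat.card G : k)⁻¹ * e g) (e g⁻¹)) ?_ ?_
  · have (g : G) : z (Nat.card G : k)⁻¹ * e g * e g⁻¹ = z (Nat.card G : k)⁻¹ := by
      rw [mul_assoc, ← map_mul, mul_inv_cancel, map_one, mul_one]
    simp only [map_sum, mulMap_btmul, this, Finset.sum_const, Finset.card_univ]
    rw [← Nat.card_eq_fintype_card, nsmul_eq_mul, ← map_natCast (algebraMap k _), ← map_mul,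
      mul_inv_cancel₀ hG, map_one]
  · intro a
    induction a using MonoidAlgebra.induction_on with
    | of h =>
      simp only [map_sum, leftMul_btmul, rightMul_btmul]
      refine Fintype.sum_equiv (Equiv.mulLeft h) _ _ fun g => ?_
      have h1 : e (h * g)⁻¹ * MonoidAlgebra.of k G h = e g⁻¹ := by
        rw [← map_mul]; congr 1; group
      have h2 : MonoidAlgebra.of k G h * (z (Nat.card G : k)⁻¹ * e g) =
          z (Nat.card G : k)⁻¹ * e (h * g) := by
        rw [← mul_assoc, ← Algebra.commutes, mul_assoc, ← map_mul]
      simp only [Equiv.coe_mulLeft, h1, h2]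
    | add a b ha hb => rw [leftMul_add, rightMul_add, ha, hb]
    | smul r a ha =>
      -- A scalar crosses the tensor sign because it lies in `B`; only here is it needed that `S`
      -- contains the scalars.
      rw [Algebra.smul_def, leftMul_mul, ha, rightMul_mul, ← rightMul_leftMul]
      congr 1
      simp only [map_sum, leftMul_btmul, rightMul_btmul]
      refine Finset.sum_congr rfl fun g _ => ?_
      rw [Algebra.commutes, ← Algebra.commutes r (e g⁻¹)]
      exact btmul_balanced B _ ⟨z r, hz r⟩ _

end RingExtension

/-! ### Frobenius systems for centralizers -/

/-- A Frobenius homomorphism from a ring onto the centralizer of `c`, with a dual basis. -/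
structure FrobeniusSystem (A : Type*) [Ring A] (c : A) where
  E : A →+ A
  commute_E : ∀ a, Commute c (E a)
  E_mul_left : ∀ s, Commute c s → ∀ a, E (s * a) = s * E a
  E_mul_right : ∀ s, Commute c s → ∀ a, E (a * s) = E a * s
  idx : Type
  [instFintypeIdx : Fintype idx]
  x : idx → A
  y : idx → A
  sum_left : ∀ a, ∑ j, E (a * x j) * y j = a
  sum_right : ∀ a, ∑ j, x j * E (y j * a) = a

namespace FrobeniusSystem

attribute [instance] FrobeniusSystem.instFintypeIdx

variable {A : Type*} [Ring A]

/-- The isomorphism is `x ↦ E (· * x)`. By `sum_left` the identity of `A` factors through the finite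
free module of families indexed by `F.idx`, whence finiteness and projectivity; `sum_right` recovers
`x` from its functional. -/
theorem isFrobenius {c : A} (F : FrobeniusSystem A c) (B : Subring A)
    (hB : ∀ a, a ∈ B ↔ Commute c a) : RingExtension.IsFrobenius B := by
  let E (x : A) : A →ₗ[B] B :=
    { toFun := fun y => ⟨F.E (y * x), (hB _).2 (F.commute_E _)⟩
      map_add' := fun y y' => Subtype.ext (by simp [add_mul])
      map_smul' := fun s y => Subtype.ext (by
        simpa [Subring.smul_def, mul_assoc] using F.E_mul_left s ((hB _).1 s.2) (y * x)) }
  have hE (x y : A) : (E x y : A) = F.E (y * x) := rfl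
  have key : (Fintype.linearCombination B F.y) ∘ₗ (LinearMap.pi fun j => E (F.x j)) =
      LinearMap.id := LinearMap.ext fun a => by
    simpa [Fintype.linearCombination_apply, Subring.smul_def, hE] using F.sum_left a
  refine ⟨Module.Finite.of_surjective (Fintype.linearCombination B F.y)
      fun a => ⟨_, LinearMap.congr_fun key a⟩, Module.Projective.of_split _ _ key,
    AddEquiv.ofBijective (AddMonoidHom.mk' E fun x x' => LinearMap.ext fun y =>
      Subtype.ext (by simp [hE, mul_add])) ⟨?_, ?_⟩, ?_, ?_⟩
  · rw [injective_iff_map_eq_zero]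
    intro x hx
    rw [← F.sum_right x]
    refine Finset.sum_eq_zero fun j _ => ?_
    have : (E x (F.y j) : A) = 0 := by
      rw [show E x = 0 from hx]; rfl
    rw [← hE, this, mul_zero]
  · intro f
    -- Applying `f` to `sum_left` gives `f a = ∑ E (a * xⱼ) * f yⱼ`, and the right factors can be
    -- moved inside `E`.
    refine ⟨∑ j, F.x j * f (F.y j), LinearMap.ext fun a => Subtype.ext ?_⟩
    have h := congrArg f (F.sum_left a)
    rw [map_sum] at h
    change F.E (a * _) = _
    rw [← h, Finset.mul_sum, map_sum, AddSubmonoidClass.coe_finsetSum]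
    refine Finset.sum_congr rfl fun j _ => ?_
    rw [← mul_assoc, F.E_mul_right _ ((hB _).1 (f (F.y j)).2)]
    exact congrArg Subtype.val (f.map_smul (E (F.x j) a) (F.y j)).symm
  · intro a x y
    refine Subtype.ext ?_
    change F.E (y * (a * x)) = F.E (y * a * x)
    rw [mul_assoc]
  · intro x b y
    refine Subtype.ext ?_
    change F.E (y * (x * b)) = F.E (y * x) * b
    rw [← mul_assoc, F.E_mul_right _ ((hB _).1 b.2)]

/-- Transport of a Frobenius system along a ring isomorphism. -/
def congr {A' : Type*} [Ring A'] (φ : A ≃+* A') {c : A} (F : FrobeniusSystem A' (φ c)) :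
    FrobeniusSystem A c where
  E := (φ.symm : A' →+ A).comp (F.E.comp (φ : A →+ A'))
  commute_E a := by
    have := (F.commute_E (φ a)).map φ.symm
    simpa using this
  E_mul_left s hs a := by simp [F.E_mul_left _ (hs.map φ)]
  E_mul_right s hs a := by simp [F.E_mul_right _ (hs.map φ)]
  idx := F.idx
  x := fun j => φ.symm (F.x j)
  y := fun j => φ.symm (F.y j)
  sum_left a := φ.injective (by simp [F.sum_left])
  sum_right a := φ.injective (by simp [F.sum_right])

/-- The product of finitely many Frobenius systems. -/
def pi {n : ℕ} {A : Fin n → Type*} [∀ i, Ring (A i)] {c : ∀ i, A i}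
    (F : ∀ i, FrobeniusSystem (A i) (c i)) : FrobeniusSystem (∀ i, A i) c where
  E := AddMonoidHom.mk' (fun a i => (F i).E (a i)) fun a b => by ext i; simp
  commute_E a := funext fun i => (F i).commute_E (a i)
  E_mul_left s hs a := funext fun i => (F i).E_mul_left _ (congrFun hs i) _
  E_mul_right s hs a := funext fun i => (F i).E_mul_right _ (congrFun hs i) _
  idx := Σ i, (F i).idx
  x := fun j => Pi.single j.1 ((F j.1).x j.2)
  y := fun j => Pi.single j.1 ((F j.1).y j.2)
  sum_left a := by
    ext i
    rw [Fintype.sum_sigma, Finset.sum_apply, Finset.sum_eq_single i]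
    · simpa using (F i).sum_left (a i)
    · intro i' _ hi
      simp [Pi.single_eq_of_ne' hi]
    · simp
  sum_right a := by
    ext i
    rw [Fintype.sum_sigma, Finset.sum_apply, Finset.sum_eq_single i]
    · simpa using (F i).sum_right (a i)
    · intro i' _ hi
      simp [Pi.single_eq_of_ne' hi]
    · simp

end FrobeniusSystem

/-! ### Frobenius systems from the minimal polynomial of a matrix -/

section Casimir

open Polynomial LinearMap

variable {k A : Type*} [Field k] [Ring A] [Algebra k A]

/-- The map `a ↦ ∑ fₗ cⁱ a cʲ`, over all `i + j + 1 = l`, where `f = ∑ fₗ Xˡ`. -/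
noncomputable def casimirMap (f : k[X]) (c : A) : A →ₗ[k] A :=
  ∑ l ∈ Finset.range (f.natDegree + 1), f.coeff l •
    ∑ i ∈ Finset.range l, mulLeft k c ^ i * mulRight k c ^ (l - 1 - i)

theorem casimirMap_apply (f : k[X]) (c a : A) :
    casimirMap f c a = ∑ l ∈ Finset.range (f.natDegree + 1), f.coeff l •
      ∑ i ∈ Finset.range l, c ^ i * a * c ^ (l - 1 - i) := by
  simp [casimirMap, LinearMap.sum_apply, pow_mulLeft, pow_mulRight, mul_assoc]

/-- Geometric sums telescope: `(L - R) * casimirMap f c = f(L) - f(R)`, which is left minus right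
multiplication by `f(c) = 0`. -/
theorem commute_casimirMap {f : k[X]} {c : A} (hf : aeval c f = 0) (a : A) :
    Commute c (casimirMap f c a) := by
  have h : (mulLeft k c - mulRight k c) * casimirMap f c = 0 := by
    have h1 : (mulLeft k c - mulRight k c) * casimirMap f c =
        mulLeft k (aeval c f) - mulRight k (aeval c f) := by
      rw [casimirMap, Finset.mul_sum]
      simp only [mul_smul_comm, (commute_mulLeft_right c c).mul_geom_sum₂]
      ext x
      simp [aeval_eq_sum_range, LinearMap.sum_apply, Finset.sum_mul, Finset.mul_sum,
        pow_mulLeft, pow_mulRight, smul_sub, Finset.sum_sub_distrib]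
    rw [h1, hf]; ext; simp
  have := LinearMap.congr_fun h a
  rw [commute_iff_eq]
  simpa [sub_eq_zero] using this

theorem casimirMap_mul_left (f : k[X]) {c s : A} (h : Commute c s) (a : A) :
    casimirMap f c (s * a) = s * casimirMap f c a := by
  simp only [casimirMap_apply, Finset.mul_sum, mul_smul_comm]
  refine Finset.sum_congr rfl fun l _ => ?_
  congr 1
  refine Finset.sum_congr rfl fun i _ => ?_
  rw [← mul_assoc, (h.pow_left i).eq, mul_assoc s, mul_assoc s]

theorem casimirMap_mul_right (f : k[X]) {c s : A} (h : Commute c s) (a : A) :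
    casimirMap f c (a * s) = casimirMap f c a * s := by
  simp only [casimirMap_apply, Finset.sum_mul, smul_mul_assoc]
  refine Finset.sum_congr rfl fun l _ => ?_
  congr 1
  refine Finset.sum_congr rfl fun i _ => ?_
  rw [mul_assoc, mul_assoc, ← (h.pow_left _).eq]
  simp only [mul_assoc]

/-- The powers of `c` below the degree of its minimal polynomial are independent, so values on them
can be prescribed. This choice isolates one term of `casimirMap`. -/
theorem exists_dual_pow [FiniteDimensional k A] [Nontrivial A] (c : A) :
    ∃ τ : A →ₗ[k] k, ∀ i < (minpoly k c).natDegree,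
      τ (c ^ i) = if i + 1 = (minpoly k c).natDegree then 1 else 0 := by
  have hli := linearIndependent_pow (K := k) c
  obtain ⟨τ, hτ⟩ := ((Module.Basis.span hli).constr k fun i =>
    if (i : ℕ) + 1 = (minpoly k c).natDegree then (1 : k) else 0).exists_extend
  refine ⟨τ, fun i hi => ?_⟩
  have h := LinearMap.congr_fun hτ (Module.Basis.span hli ⟨i, hi⟩)
  rw [Module.Basis.constr_basis] at h
  simpa [Module.Basis.span_apply] using h

/-- In a matrix algebra every functional `τ`, as a map `a ↦ τ a • 1`, is of the form
`a ↦ ∑ x a y`. -/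
theorem Matrix.sum_single_mul_mul_single {n : Type*} [Fintype n] [DecidableEq n]
    (τ : Matrix n n k →ₗ[k] k) (a : Matrix n n k) :
    ∑ j : n × n × n, single j.1 j.2.1 1 * a * (τ (single j.2.1 j.2.2 1) • single j.2.2 j.1 1) =
      τ a • (1 : Matrix n n k) := by
  have h (r p q : n) : single r p 1 * a * (τ (single p q 1) • single q r 1) =
      τ (single p q (a p q)) • single r r (1 : k) := by
    have : single p q (a p q) = a p q • single p q (1 : k) := by simp [smul_single]
    rw [this, map_smul, mul_smul_comm, single_mul_mul_single]
    simp [smul_single, mul_comm]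
  simp only [h, Fintype.sum_prod_type]
  have h2 (r : n) : ∑ p, ∑ q, τ (single p q (a p q)) • single r r (1 : k) =
      τ a • single r r (1 : k) := by
    conv_rhs => rw [Matrix.matrix_eq_sum_single a]
    simp [map_sum, Finset.sum_smul]
  simp only [h2, ← Finset.smul_sum]
  congr 1
  ext i j
  simp [Matrix.sum_apply, single_apply, Matrix.one_apply, ite_and]

/-- The Frobenius system of the centralizer of a matrix. -/
theorem nonempty_frobeniusSystem_matrix {n : ℕ} [NeZero n] (c : Matrix (Fin n) (Fin n) k) :
    Nonempty (FrobeniusSystem (Matrix (Fin n) (Fin n) k) c) := by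
  obtain ⟨τ, hτ⟩ := exists_dual_pow (k := k) c
  have hm := minpoly.monic (Algebra.IsIntegral.isIntegral (R := k) c)
  have hd := minpoly.natDegree_pos (Algebra.IsIntegral.isIntegral (R := k) c)
  have hcoeff : (minpoly k c).coeff (minpoly k c).natDegree = 1 := hm
  set f := minpoly k c
  let x : Fin n × Fin n × Fin n → Matrix (Fin n) (Fin n) k := fun j => Matrix.single j.1 j.2.1 1
  let y : Fin n × Fin n × Fin n → Matrix (Fin n) (Fin n) k := fun j =>
    τ (Matrix.single j.2.1 j.2.2 1) • Matrix.single j.2.2 j.1 1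
  have hxy (a : Matrix (Fin n) (Fin n) k) : ∑ j, x j * a * y j = τ a • 1 :=
    Matrix.sum_single_mul_mul_single τ a
  have hxy' (a b : Matrix (Fin n) (Fin n) k) : ∑ j, b * x j * a * y j = τ a • b := by
    simp only [mul_assoc, ← Finset.mul_sum]
    simp only [← mul_assoc, hxy, mul_smul_comm, mul_one]
  have hxy'' (a b : Matrix (Fin n) (Fin n) k) : ∑ j, x j * (a * (y j * b)) = τ a • b := by
    simp only [← mul_assoc, ← Finset.sum_mul]
    simp only [hxy, smul_mul_assoc, one_mul]
  refine ⟨{ E := (casimirMap f c).toAddMonoidHom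
            commute_E := commute_casimirMap (minpoly.aeval k c)
            E_mul_left := fun s hs a => casimirMap_mul_left f hs a
            E_mul_right := fun s hs a => casimirMap_mul_right f hs a
            idx := Fin n × Fin n × Fin n
            x := x
            y := y
            sum_left := fun a => ?_
            sum_right := fun a => ?_ }⟩
  -- Summing over `j` contracts whatever stands between `x j` and `y j` to its value under `τ`.
  · have h1 : ∑ j, casimirMap f c (a * x j) * y j = ∑ l ∈ Finset.range (f.natDegree + 1),
        f.coeff l • ∑ i ∈ Finset.range l, τ (c ^ (l - 1 - i)) • (c ^ i * a) := by
      simp only [casimirMap_apply, Finset.sum_mul, smul_mul_assoc]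
      rw [Finset.sum_comm]
      refine Finset.sum_congr rfl fun l _ => ?_
      rw [← Finset.smul_sum, Finset.sum_comm]
      congr 1
      refine Finset.sum_congr rfl fun i _ => ?_
      rw [← hxy']
      simp only [mul_assoc]
    refine h1.trans ?_
    -- The exponent `l - 1 - i` reaches `natDegree - 1` only for `l = natDegree` and `i = 0`.
    rw [Finset.sum_eq_single f.natDegree, hcoeff, one_smul, Finset.sum_eq_single 0, hτ]
    · simp [Nat.sub_add_cancel hd]
    · omega
    · intro i hi h0
      rw [Finset.mem_range] at hi
      rw [hτ _ (by omega), if_neg (by omega), zero_smul]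
    · simp [hd.ne']
    · intro l hl hne
      rw [Finset.mem_range] at hl
      rw [Finset.sum_eq_zero, smul_zero]
      intro i hi
      rw [Finset.mem_range] at hi
      rw [hτ _ (by omega), if_neg (by omega), zero_smul]
    · simp
  · have h1 : ∑ j, x j * casimirMap f c (y j * a) = ∑ l ∈ Finset.range (f.natDegree + 1),
        f.coeff l • ∑ i ∈ Finset.range l, τ (c ^ i) • (a * c ^ (l - 1 - i)) := by
      simp only [casimirMap_apply, Finset.mul_sum, mul_smul_comm]
      rw [Finset.sum_comm]
      refine Finset.sum_congr rfl fun l _ => ?_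
      rw [← Finset.smul_sum, Finset.sum_comm]
      congr 1
      refine Finset.sum_congr rfl fun i _ => ?_
      rw [← hxy'']
      simp only [mul_assoc]
    refine h1.trans ?_
    rw [Finset.sum_eq_single f.natDegree, hcoeff, one_smul,
      Finset.sum_eq_single (f.natDegree - 1), hτ]
    · simp [Nat.sub_add_cancel hd]
    · omega
    · intro i hi h0
      rw [Finset.mem_range] at hi
      rw [hτ _ (by omega), if_neg (by omega), zero_smul]
    · simp [hd]
    · intro l hl hne
      rw [Finset.mem_range] at hl
      rw [Finset.sum_eq_zero, smul_zero]
      intro i hi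
      rw [Finset.mem_range] at hi
      rw [hτ _ (by omega), if_neg (by omega), zero_smul]
    · simp

end Casimir

/-! ### Transport and products of cell data -/

namespace CellDatum

attribute [instance] CellDatum.instPartialOrder CellDatum.instFiniteP CellDatum.instFintypeM

variable {R : Type*} [CommRing R]

/-- Transport of a cell datum along an isomorphism of algebras. -/
noncomputable def congr {A A' : Type*} [Ring A] [Algebra R A] [Ring A'] [Algebra R A']
    (D : CellDatum R A) (φ : A ≃ₐ[R] A') : CellDatum R A' where
  P := D.P
  M := D.M
  C := D.C.map φ.toLinearEquiv
  ι := φ.toLinearMap ∘ₗ D.ι ∘ₗ φ.symm.toLinearMap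
  ι_mul a b := by simp [D.ι_mul]
  ι_ι a := by simp [D.ι_ι]
  ι_C p i j := by simp [D.ι_C]
  r a := D.r (φ.symm a)
  mul_C a p i j := by
    have h := Submodule.mem_map_of_mem (f := φ.toLinearMap) (D.mul_C (φ.symm a) p i j)
    rw [Submodule.map_span] at h
    have h' : φ.toLinearMap (φ.symm a * D.C ⟨p, i, j⟩ -
        ∑ u, D.r (φ.symm a) p u i • D.C ⟨p, u, j⟩) =
        a * (D.C.map φ.toLinearEquiv) ⟨p, i, j⟩ -
          ∑ u, D.r (φ.symm a) p u i • (D.C.map φ.toLinearEquiv) ⟨p, u, j⟩ := by simp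
    rw [← h']
    refine Submodule.span_mono ?_ h
    rintro _ ⟨_, ⟨q, hq, s, t, rfl⟩, rfl⟩
    exact ⟨q, hq, s, t, by simp⟩

/-- The basis of a finite product of algebras with cell data. -/
noncomputable def piBasis {n : ℕ} {A : Fin n → Type*} [∀ i, Ring (A i)] [∀ i, Algebra R (A i)]
    (D : ∀ i, CellDatum R (A i)) :
    Module.Basis (Σ p : Σ i, (D i).P, (D p.1).M p.2 × (D p.1).M p.2) R (∀ i, A i) :=
  (Pi.basis fun i => (D i).C).reindex
    (Equiv.sigmaAssoc fun i (p : (D i).P) => (D i).M p × (D i).M p).symm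

theorem piBasis_apply {n : ℕ} {A : Fin n → Type*} [∀ i, Ring (A i)] [∀ i, Algebra R (A i)]
    (D : ∀ i, CellDatum R (A i)) (i : Fin n) (p : (D i).P) (s t : (D i).M p) :
    piBasis D ⟨⟨i, p⟩, s, t⟩ = Pi.single i ((D i).C ⟨p, s, t⟩) := by
  rw [piBasis, Module.Basis.reindex_apply, Equiv.symm_symm]
  exact Pi.basis_apply _ _

/-- The cell datum of a finite product of algebras. -/
noncomputable def pi {n : ℕ} {A : Fin n → Type*} [∀ i, Ring (A i)] [∀ i, Algebra R (A i)]
    (D : ∀ i, CellDatum R (A i)) : CellDatum R (∀ i, A i) where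
  -- The order is the disjoint one: cells of different factors are incomparable.
  P := Σ i, (D i).P
  M p := (D p.1).M p.2
  C := piBasis D
  ι := LinearMap.pi fun i => (D i).ι ∘ₗ LinearMap.proj i
  ι_mul a b := by ext i; simp [(D i).ι_mul]
  ι_ι a := by ext i; simp [(D i).ι_ι]
  ι_C := by
    rintro ⟨i, p⟩ s t
    ext i'
    rw [piBasis_apply, piBasis_apply]
    obtain rfl | h := eq_or_ne i' i
    · simp [(D i').ι_C]
    · simp [h]
  r a p := (D p.1).r (a p.1) p.2
  mul_C := by
    rintro a ⟨i, p⟩ (s : (D i).M p) (t : (D i).M p)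
    have h := Submodule.mem_map_of_mem (f := LinearMap.single R A i) ((D i).mul_C (a i) p s t)
    rw [Submodule.map_span] at h
    have h' : LinearMap.single R A i (a i * (D i).C ⟨p, s, t⟩ -
        ∑ u, (D i).r (a i) p u s • (D i).C ⟨p, u, t⟩) =
        a * piBasis D ⟨⟨i, p⟩, s, t⟩ -
          ∑ u : (D i).M p, (D i).r (a i) p u s • piBasis D ⟨⟨i, p⟩, u, t⟩ := by
      have hb := piBasis_apply D i p
      simp only [map_sub, map_sum, map_smul, LinearMap.coe_single, ← hb]
      rw [hb]
      congr 1
      ext i'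
      obtain rfl | h := eq_or_ne i' i <;> simp [*]
    refine h' ▸ Submodule.span_mono ?_ h
    rintro _ ⟨_, ⟨q, hq, s, t, rfl⟩, rfl⟩
    exact ⟨⟨i, q⟩, Sigma.mk_lt_mk_iff.2 hq, s, t, (piBasis_apply D i q s t).symm⟩

end CellDatum

theorem IsCellularAlgebra.congr {R A A' : Type*} [CommRing R] [Ring A] [Algebra R A] [Ring A']
    [Algebra R A'] (h : IsCellularAlgebra R A) (φ : A ≃ₐ[R] A') : IsCellularAlgebra R A' :=
  h.map fun D => D.congr φ

theorem IsCellularAlgebra.pi {R : Type*} [CommRing R] {n : ℕ} {A : Fin n → Type*}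
    [∀ i, Ring (A i)] [∀ i, Algebra R (A i)] (h : ∀ i, IsCellularAlgebra R (A i)) :
    IsCellularAlgebra R (∀ i, A i) :=
  ⟨CellDatum.pi fun i => (h i).some⟩

/-! ### Centralizers under isomorphisms and products -/

namespace Subalgebra

variable {R : Type*} [CommRing R]

theorem mem_centralizer_singleton {A : Type*} [Ring A] [Algebra R A] {c a : A} :
    a ∈ centralizer R {c} ↔ Commute c a := by
  simp [mem_centralizer_iff, commute_iff_eq]

/-- An isomorphism of algebras restricts to the centralizers. -/
def centralizerCongr {A A' : Type*} [Ring A] [Algebra R A] [Ring A'] [Algebra R A']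
    (φ : A ≃ₐ[R] A') (c : A) : centralizer R {c} ≃ₐ[R] centralizer R {φ c} :=
  AlgEquiv.ofAlgHom
    ((φ.toAlgHom.comp (centralizer R {c}).val).codRestrict _ fun a =>
      mem_centralizer_singleton.2 ((mem_centralizer_singleton.1 a.2).map φ))
    ((φ.symm.toAlgHom.comp (centralizer R {φ c}).val).codRestrict _ fun a =>
      mem_centralizer_singleton.2 (by
        simpa using (mem_centralizer_singleton.1 a.2).map φ.symm))
    (by ext; simp) (by ext; simp)

/-- The centralizer of an element of a product is the product of the centralizers. -/
def centralizerPi {ι : Type*} {A : ι → Type*} [∀ i, Ring (A i)] [∀ i, Algebra R (A i)]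
    (c : ∀ i, A i) : (∀ i, centralizer R {c i}) ≃ₐ[R] centralizer R {c} where
  toFun a := ⟨fun i => a i, mem_centralizer_singleton.2
    (funext fun i => mem_centralizer_singleton.1 (a i).2)⟩
  invFun a i := ⟨(a : ∀ i, A i) i, mem_centralizer_singleton.2
    (congrFun (mem_centralizer_singleton.1 a.2) i)⟩
  left_inv _ := rfl
  right_inv _ := rfl
  map_mul' _ _ := rfl
  map_add' _ _ := rfl
  commutes' _ := rfl

end Subalgebra

/-! ### Centralizers of Jordan matrices -/

namespace JordanMatrix

set_option linter.unusedSectionVars false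

variable {k : Type*} [Field k] {T : Type} [Fintype T] [DecidableEq T] {m : ℕ} {e : T → ℕ}

/-- The Jordan matrix with blocks labelled by `T`, of size `e j` and eigenvalue `l j`. -/
def jordan (e : T → ℕ) (l : T → k) : Matrix (Σ j, Fin (e j)) (Σ j, Fin (e j)) k :=
  Matrix.diagonal (fun x => l x.1) +
    Matrix.of fun x y => if x.1 = y.1 ∧ (x.2 : ℕ) + 1 = y.2 then 1 else 0

/-- The entries of a block matrix, extended by zero. -/
def entry (X : Matrix (Σ j, Fin (e j)) (Σ j, Fin (e j)) k) (i : T) (a : ℕ) (j : T) (b : ℕ) : k :=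
  if h : a < e i ∧ b < e j then X ⟨i, a, h.1⟩ ⟨j, b, h.2⟩ else 0

theorem entry_val (X : Matrix (Σ j, Fin (e j)) (Σ j, Fin (e j)) k) (x y : Σ j, Fin (e j)) :
    entry X x.1 x.2 y.1 y.2 = X x y := by
  simp [entry]

theorem matrix_ext {X Y : Matrix (Σ j, Fin (e j)) (Σ j, Fin (e j)) k}
    (h : ∀ i a j b, a < e i → b < e j → entry X i a j b = entry Y i a j b) : X = Y := by
  ext x y
  rw [← entry_val X, ← entry_val Y, h _ _ _ _ x.2.2 y.2.2]

theorem entry_of_le_left (X : Matrix (Σ j, Fin (e j)) (Σ j, Fin (e j)) k) {i j : T} {a b : ℕ}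
    (h : e i ≤ a) : entry X i a j b = 0 :=
  dif_neg fun h' => by omega

theorem jordan_mul_apply (l : T → k) (X : Matrix (Σ j, Fin (e j)) (Σ j, Fin (e j)) k)
    {i j : T} {a b : ℕ} (ha : a < e i) (hb : b < e j) :
    entry (jordan e l * X) i a j b = l i * entry X i a j b + entry X i (a + 1) j b := by
  have h1 : entry (jordan e l * X) i a j b =
      (jordan e l * X) ⟨i, a, ha⟩ ⟨j, b, hb⟩ := dif_pos ⟨ha, hb⟩
  have h2 : entry X i a j b = X ⟨i, a, ha⟩ ⟨j, b, hb⟩ := dif_pos ⟨ha, hb⟩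
  rw [h1, h2, jordan, add_mul, Matrix.add_apply, Matrix.diagonal_mul, Matrix.mul_apply]
  congr 1
  simp only [Matrix.of_apply, ite_mul, one_mul, zero_mul]
  by_cases h : a + 1 < e i
  · rw [Finset.sum_eq_single ⟨i, a + 1, h⟩, if_pos ⟨rfl, rfl⟩, entry, dif_pos ⟨h, hb⟩]
    · rintro ⟨z, t⟩ - hz
      refine if_neg ?_
      rintro ⟨rfl, ht⟩
      exact hz (by congr; exact Fin.ext ht.symm)
    · simp
  · rw [entry, dif_neg fun h' => h h'.1]
    refine Finset.sum_eq_zero fun z _ => if_neg ?_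
    obtain ⟨z, t⟩ := z
    rintro ⟨rfl, ht⟩
    exact h (ht ▸ t.2)

theorem mul_jordan_apply (l : T → k) (X : Matrix (Σ j, Fin (e j)) (Σ j, Fin (e j)) k)
    {i j : T} {a b : ℕ} (ha : a < e i) (hb : b < e j) :
    entry (X * jordan e l) i a j b =
      l j * entry X i a j b + if b = 0 then 0 else entry X i a j (b - 1) := by
  have h1 : entry (X * jordan e l) i a j b =
      (X * jordan e l) ⟨i, a, ha⟩ ⟨j, b, hb⟩ := dif_pos ⟨ha, hb⟩
  have h2 : entry X i a j b = X ⟨i, a, ha⟩ ⟨j, b, hb⟩ := dif_pos ⟨ha, hb⟩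
  rw [h1, h2, jordan, mul_add, Matrix.add_apply, Matrix.mul_diagonal, Matrix.mul_apply,
    mul_comm (l j)]
  congr 1
  simp only [Matrix.of_apply, mul_ite, mul_one, mul_zero]
  split_ifs with h
  · exact Finset.sum_eq_zero fun z _ => if_neg (by simp [h])
  · have hb' : b - 1 < e j := by omega
    rw [Finset.sum_eq_single ⟨j, b - 1, hb'⟩, if_pos ⟨rfl, by simp; omega⟩, entry,
      dif_pos ⟨ha, hb'⟩]
    · rintro ⟨z, t⟩ - hz
      refine if_neg ?_
      rintro ⟨rfl, ht⟩
      exact hz (by congr; exact Fin.ext (by simp at ht ⊢; omega))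
    · simp

theorem commute_iff (l : T → k) (X : Matrix (Σ j, Fin (e j)) (Σ j, Fin (e j)) k) :
    Commute (jordan e l) X ↔ ∀ i a j b, a < e i → b < e j →
      l i * entry X i a j b + entry X i (a + 1) j b =
        l j * entry X i a j b + if b = 0 then 0 else entry X i a j (b - 1) := by
  rw [commute_iff_eq]
  constructor
  · intro h i a j b ha hb
    rw [← jordan_mul_apply l X ha hb, h, mul_jordan_apply l X ha hb]
  · intro h
    refine matrix_ext fun i a j b ha hb => ?_
    rw [jordan_mul_apply l X ha hb, mul_jordan_apply l X ha hb, h i a j b ha hb]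

/-! ### Shape of the matrices commuting with a Jordan matrix -/

section Commutant

variable {l : T → k} {X : Matrix (Σ j, Fin (e j)) (Σ j, Fin (e j)) k}
  (hX : Commute (jordan e l) X)
include hX

/-- Commutation reads `(l i - l j) X(a, b) = X(a, b - 1) - X(a + 1, b)`, with zero outside the
block. The induction goes through the columns from the left, and up each column from the bottom. -/
theorem entry_eq_zero_of_ne {i j : T} (hij : l i ≠ l j) (a b : ℕ) : entry X i a j b = 0 := by
  have hd : l i - l j ≠ 0 := sub_ne_zero.2 hij
  induction b generalizing a with
  | zero =>
    by_cases hb : 0 < e j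
    swap
    · exact dif_neg fun h => hb h.2
    induction h : e i - a generalizing a with
    | zero => exact entry_of_le_left X (by omega)
    | succ n ih =>
      have h1 := (commute_iff l X).1 hX i a j 0 (by omega) hb
      rw [ih (a + 1) (by omega), if_pos rfl] at h1
      refine (mul_eq_zero.1 ?_).resolve_left hd
      linear_combination h1
  | succ b ihb =>
    by_cases hb : b + 1 < e j
    swap
    · exact dif_neg fun h => hb h.2
    induction h : e i - a generalizing a with
    | zero => exact entry_of_le_left X (by omega)
    | succ n ih =>
      have h1 := (commute_iff l X).1 hX i a j (b + 1) (by omega) hb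
      rw [ih (a + 1) (by omega), if_neg b.succ_ne_zero, Nat.add_sub_cancel, ihb] at h1
      refine (mul_eq_zero.1 ?_).resolve_left hd
      linear_combination h1

theorem entry_succ_zero {i j : T} (hij : l i = l j) (hj : 0 < e j) (a : ℕ) :
    entry X i (a + 1) j 0 = 0 := by
  by_cases ha : a < e i
  · have h1 := (commute_iff l X).1 hX i a j 0 ha hj
    rw [hij, if_pos rfl] at h1
    linear_combination h1
  · exact entry_of_le_left X (by omega)

theorem entry_succ_succ {i j : T} (hij : l i = l j) (a : ℕ) {b : ℕ} (hb : b + 1 < e j) :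
    entry X i (a + 1) j (b + 1) = entry X i a j b := by
  by_cases ha : a < e i
  · have h1 := (commute_iff l X).1 hX i a j (b + 1) ha hb
    rw [hij, if_neg b.succ_ne_zero, Nat.add_sub_cancel] at h1
    linear_combination h1
  · rw [entry_of_le_left X (by omega), entry_of_le_left X (by omega)]

theorem entry_add {i j : T} (hij : l i = l j) (a b n : ℕ) (hb : b + n < e j) :
    entry X i (a + n) j (b + n) = entry X i a j b := by
  induction n with
  | zero => rfl
  | succ n ih => rw [← ih (by omega), ← entry_succ_succ hX hij (a + n) (b := b + n) (by omega)]; rfl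

/-- For equal eigenvalues, slide along the diagonal to column `0`, arriving in a row of positive
index. -/
theorem entry_eq_zero_of_lt {i j : T} {a b : ℕ} (hab : b < a) : entry X i a j b = 0 := by
  by_cases hb : b < e j
  swap
  · exact dif_neg fun h => hb h.2
  by_cases hij : l i = l j
  swap
  · exact entry_eq_zero_of_ne hX hij a b
  have h1 := entry_add hX hij (a - b - 1 + 1) 0 b (by omega)
  rw [entry_succ_zero hX hij (by omega)] at h1
  rw [← h1]
  congr 1 <;> omega

/-- An element of the commutant is determined by the last columns of its blocks. -/
theorem entry_eq_last {i j : T} (hij : l i = l j) (a b : ℕ) (hb : b < e j) :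
    entry X i a j b = entry X i (a + (e j - 1 - b)) j (e j - 1) := by
  rw [← entry_add hX hij a b (e j - 1 - b) (by omega)]
  congr 1
  omega

end Commutant

/-- The partial identity matrix in the block `(i, j)` whose last column has its only nonzero entry
in row `s`. -/
def shift (e : T → ℕ) (k : Type*) [Field k] (i j : T) (s : ℕ) :
    Matrix (Σ j, Fin (e j)) (Σ j, Fin (e j)) k :=
  Matrix.of fun x y => if x.1 = i ∧ y.1 = j ∧ (x.2 : ℕ) ≤ s ∧ (x.2 : ℕ) + e j = y.2 + s + 1
    then 1 else 0

theorem entry_shift {i j : T} {s : ℕ} (i' a j' b) (ha : a < e i') (hb : b < e j') :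
    entry (shift e k i j s) i' a j' b =
      if i' = i ∧ j' = j ∧ a ≤ s ∧ a + e j = b + s + 1 then 1 else 0 := by
  simp [entry, shift, ha, hb]

/-- Since `s < e j` the diagonal starts in row `0`, and since `s < e i` it ends in the last column,
so the Toeplitz relations hold at the border too. -/
theorem commute_shift {l : T → k} {i j : T} {s : ℕ} (hij : l i = l j) (hi : s < e i)
    (hj : s < e j) : Commute (jordan e l) (shift e k i j s) := by
  rw [commute_iff]
  intro i' a j' b ha hb
  have h1 : l i' * entry (shift e k i j s) i' a j' b =
      l j' * entry (shift e k i j s) i' a j' b := by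
    rw [entry_shift _ _ _ _ ha hb]
    split_ifs with h
    · rw [h.1, h.2.1, hij]
    · simp
  rw [h1]
  congr 1
  by_cases hij' : i' = i ∧ j' = j
  swap
  · have h0 (a b) : entry (shift e k i j s) i' a j' b = 0 := by
      simp only [entry, shift, Matrix.of_apply]
      split_ifs <;> tauto
    simp [h0]
  obtain ⟨rfl, rfl⟩ := hij'
  have h2 : entry (shift e k i' j' s) i' (a + 1) j' b =
      if a + 1 ≤ s ∧ a + 1 + e j' = b + s + 1 then 1 else 0 := by
    by_cases ha' : a + 1 < e i'
    · rw [entry_shift _ _ _ _ ha' hb]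
      simp
    · rw [entry_of_le_left _ (by omega), if_neg (by omega)]
  rw [h2]
  by_cases hb0 : b = 0
  · rw [if_pos hb0, if_neg (by omega)]
  · rw [if_neg hb0, entry_shift _ _ _ _ ha (by omega)]
    simp only [true_and]
    congr 1
    rw [eq_iff_iff]
    omega

/-- The anti-transpose in each block: the flip of a matrix along the antidiagonals. -/
def flip (X : Matrix (Σ j, Fin (e j)) (Σ j, Fin (e j)) k) :
    Matrix (Σ j, Fin (e j)) (Σ j, Fin (e j)) k :=
  X.transpose.submatrix (Equiv.sigmaCongrRight fun _ => Fin.revPerm)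
    (Equiv.sigmaCongrRight fun _ => Fin.revPerm)

theorem flip_apply (X : Matrix (Σ j, Fin (e j)) (Σ j, Fin (e j)) k) (x y) :
    flip X x y = X ⟨y.1, y.2.rev⟩ ⟨x.1, x.2.rev⟩ := rfl

theorem entry_flip (X : Matrix (Σ j, Fin (e j)) (Σ j, Fin (e j)) k) {i a j b} (ha : a < e i)
    (hb : b < e j) : entry (flip X) i a j b = entry X j (e j - 1 - b) i (e i - 1 - a) := by
  rw [entry, dif_pos ⟨ha, hb⟩, entry, dif_pos ⟨by omega, by omega⟩, flip_apply]
  congr 2 <;> ext <;> simp <;> omega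

theorem flip_mul (X Y : Matrix (Σ j, Fin (e j)) (Σ j, Fin (e j)) k) :
    flip (X * Y) = flip Y * flip X := by
  rw [flip, flip, flip, Matrix.transpose_mul, Matrix.submatrix_mul_equiv]

theorem flip_flip (X : Matrix (Σ j, Fin (e j)) (Σ j, Fin (e j)) k) : flip (flip X) = X := by
  ext x y
  simp [flip_apply]

/-- The plain transpose would turn the superdiagonal into a subdiagonal; reversing each block
restores it. -/
theorem flip_jordan (l : T → k) : flip (jordan e l) = jordan e l := by
  ext ⟨i, a⟩ ⟨j, b⟩
  rw [flip_apply, jordan, Matrix.add_apply, Matrix.add_apply]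
  congr 1
  · simp only [Matrix.diagonal_apply]
    by_cases h : i = j
    · subst h
      simp [eq_comm]
    · simp [h, Ne.symm h]
  · simp only [Matrix.of_apply]
    congr 1
    rw [eq_iff_iff]
    by_cases h : i = j
    · subst h
      simp only [true_and, Fin.val_rev]
      omega
    · simp [h, Ne.symm h]

/-- The two ends of the diagonal are exchanged, so the parameter `s` is preserved. -/
theorem flip_shift {i j : T} {s : ℕ} (hi : s < e i) (hj : s < e j) :
    flip (shift e k i j s) = shift e k j i s := by
  refine matrix_ext fun i' a j' b ha hb => ?_
  rw [entry_flip _ ha hb, entry_shift _ _ _ _ (by omega) (by omega), entry_shift _ _ _ _ ha hb]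
  congr 1
  rw [eq_iff_iff]
  constructor
  · rintro ⟨rfl, rfl, h⟩
    exact ⟨rfl, rfl, by omega, by omega⟩
  · rintro ⟨rfl, rfl, h⟩
    exact ⟨rfl, rfl, by omega, by omega⟩

theorem commute_flip {l : T → k} {X : Matrix (Σ j, Fin (e j)) (Σ j, Fin (e j)) k}
    (hX : Commute (jordan e l) X) : Commute (jordan e l) (flip X) := by
  have h := congrArg flip hX.eq
  rw [flip_mul, flip_mul, flip_jordan] at h
  exact h.symm

/-- The flip as a linear map on the commutant. -/
def flipLinear (e : T → ℕ) (l : T → k) :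
    Subalgebra.centralizer k {jordan e l} →ₗ[k] Subalgebra.centralizer k {jordan e l} where
  toFun X := ⟨flip X, Subalgebra.mem_centralizer_singleton.2
    (commute_flip (Subalgebra.mem_centralizer_singleton.1 X.2))⟩
  map_add' _ _ := rfl
  map_smul' _ _ := rfl

/-! ### Coordinates, basis and cell datum of the commutant -/

variable (e) (κ : T → Fin m) (μ : Fin m → k) (N : ℕ)

/-- The blocks of size greater than `p.2` with eigenvalue labelled by `p.1`. -/
abbrev Label (p : Fin m × Fin N) : Type := {i : T // κ i = p.1 ∧ (p.2 : ℕ) < e i}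

/-- The entries in the last columns of the blocks, as coordinates on the commutant. -/
def coords : Subalgebra.centralizer k {jordan e (μ ∘ κ)} →ₗ[k]
    ((Σ p : Fin m × Fin N, Label e κ N p × Label e κ N p) → k) where
  toFun X q := (X : Matrix (Σ j, Fin (e j)) (Σ j, Fin (e j)) k)
    ⟨q.2.1, q.1.2, q.2.1.2.2⟩ ⟨q.2.2, e q.2.2 - 1, by have := q.2.2.2.2; omega⟩
  map_add' _ _ := rfl
  map_smul' _ _ := rfl

variable {e κ μ N}

theorem coords_apply (X : Subalgebra.centralizer k {jordan e (μ ∘ κ)})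
    (q : Σ p : Fin m × Fin N, Label e κ N p × Label e κ N p) :
    coords e κ μ N X q = entry (e := e) X q.2.1 q.1.2 q.2.2 (e q.2.2 - 1) := by
  have := q.2.2.2.2
  rw [entry, dif_pos ⟨q.2.1.2.2, by omega⟩]
  rfl

/-- The basis elements of the commutant. -/
def cell (e : T → ℕ) (κ : T → Fin m) (μ : Fin m → k) (N : ℕ)
    (q : Σ p : Fin m × Fin N, Label e κ N p × Label e κ N p) :
    Subalgebra.centralizer k {jordan e (μ ∘ κ)} :=
  ⟨shift e k q.2.1 q.2.2 q.1.2, Subalgebra.mem_centralizer_singleton.2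
    (commute_shift (by simp [q.2.1.2.1, q.2.2.2.1]) q.2.1.2.2 q.2.2.2.2)⟩

theorem coords_cell (q : Σ p : Fin m × Fin N, Label e κ N p × Label e κ N p) :
    coords e κ μ N (cell e κ μ N q) = Pi.single q 1 := by
  ext q'
  have h1 := q'.2.2.2.2
  rw [coords_apply, Pi.single_apply]
  change entry (shift e k _ _ _) _ _ _ _ = _
  rw [entry_shift _ _ _ _ q'.2.1.2.2 (by omega)]
  congr 1
  rw [eq_iff_iff]
  constructor
  · obtain ⟨⟨p, s⟩, ⟨i, hi⟩, ⟨j, hj⟩⟩ := q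
    obtain ⟨⟨p', s'⟩, ⟨i', hi'⟩, ⟨j', hj'⟩⟩ := q'
    rintro ⟨h, h', h2, h3⟩
    dsimp only at *
    subst h h'
    obtain rfl : p' = p := hi'.1.symm.trans hi.1
    obtain rfl : s' = s := Fin.ext (by omega)
    rfl
  · rintro rfl
    exact ⟨rfl, rfl, le_rfl, by omega⟩

/-- An entry not already zero by eigenvalue or triangularity slides to the last column, where it is
a coordinate or falls below the block and is zero. -/
theorem coords_injective (hμ : Function.Injective μ) (hN : ∀ i, e i ≤ N) :
    Function.Injective (coords e κ μ N) := by
  rw [injective_iff_map_eq_zero]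
  intro X hX0
  have hX := Subalgebra.mem_centralizer_singleton.1 X.2
  refine Subtype.ext (matrix_ext fun i a j b ha hb => ?_)
  have h0 : entry (0 : Matrix (Σ j, Fin (e j)) (Σ j, Fin (e j)) k) i a j b = 0 := by
    simp [entry]
  refine Eq.trans ?_ h0.symm
  by_cases hij : κ i = κ j
  swap
  · exact entry_eq_zero_of_ne hX (fun h => hij (hμ h)) a b
  by_cases hab : b < a
  · exact entry_eq_zero_of_lt hX hab
  rw [entry_eq_last hX (congrArg μ hij) a b hb]
  by_cases hs : a + (e j - 1 - b) < e i
  · have := congrFun hX0 ⟨(κ j, ⟨a + (e j - 1 - b), hs.trans_le (hN i)⟩), ⟨i, hij, hs⟩,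
      ⟨j, rfl, show a + (e j - 1 - b) < e j by omega⟩⟩
    rwa [coords_apply] at this
  · exact entry_of_le_left _ (by omega)

theorem coords_surjective : Function.Surjective (coords e κ μ N) := by
  intro w
  refine ⟨∑ q, w q • cell e κ μ N q, ?_⟩
  simp only [map_sum, map_smul, coords_cell]
  ext q
  simp [Finset.sum_apply, Pi.single_apply]

/-- The basis of the commutant of a Jordan matrix. -/
noncomputable def cellBasis (hμ : Function.Injective μ) (hN : ∀ i, e i ≤ N) :
    Module.Basis (Σ p : Fin m × Fin N, Label e κ N p × Label e κ N p) k
      (Subalgebra.centralizer k {jordan e (μ ∘ κ)}) :=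
  .ofEquivFun (LinearEquiv.ofBijective (coords e κ μ N)
    ⟨coords_injective hμ hN, coords_surjective⟩)

theorem cellBasis_repr (hμ : Function.Injective μ) (hN : ∀ i, e i ≤ N) (X q) :
    (cellBasis (κ := κ) hμ hN).repr X q = coords e κ μ N X q := rfl

theorem cellBasis_apply (hμ : Function.Injective μ) (hN : ∀ i, e i ≤ N) (q) :
    cellBasis (κ := κ) hμ hN q = cell e κ μ N q := by
  refine coords_injective hμ hN ?_
  rw [coords_cell]
  ext q'
  rw [← cellBasis_repr hμ hN, Module.Basis.repr_self, Finsupp.single_eq_pi_single]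

/-- The last columns of the product of an element of the commutant with a basis element. -/
theorem coords_mul_cell (X : Subalgebra.centralizer k {jordan e (μ ∘ κ)})
    (q q' : Σ p : Fin m × Fin N, Label e κ N p × Label e κ N p) :
    coords e κ μ N (X * cell e κ μ N q) q' =
      if (q'.2.2 : T) = q.2.2 then entry (e := e) X q'.2.1 q'.1.2 q.2.1 q.1.2 else 0 := by
  have h1 := q'.2.2.2.2
  have h0 : coords e κ μ N (X * cell e κ μ N q) q' = ∑ z,
      (X : Matrix (Σ j, Fin (e j)) (Σ j, Fin (e j)) k) ⟨q'.2.1, q'.1.2, q'.2.1.2.2⟩ z *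
        shift e k q.2.1 q.2.2 q.1.2 z ⟨q'.2.2, e q'.2.2 - 1, by omega⟩ := rfl
  rw [h0]
  simp only [shift, Matrix.of_apply, mul_ite, mul_one, mul_zero]
  split_ifs with h
  -- The last column of the basis element is a unit vector, so it selects one column of `X`.
  · rw [Finset.sum_eq_single ⟨q.2.1, q.1.2, q.2.1.2.2⟩, if_pos, entry,
      dif_pos ⟨q'.2.1.2.2, q.2.1.2.2⟩]
    · refine ⟨rfl, h, le_rfl, ?_⟩
      dsimp only
      rw [← h]
      omega
    · rintro ⟨z, t⟩ - hz
      refine if_neg ?_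
      rintro ⟨rfl, -, h2, h3⟩
      refine hz (by congr; refine Fin.ext ?_; dsimp only at *; rw [← h] at h3; omega)
    · simp
  · exact Finset.sum_eq_zero fun z _ => if_neg fun h' => h h'.2.1

/-- The cell datum of the commutant of a Jordan matrix. -/
noncomputable def cellDatum (hμ : Function.Injective μ) (hN : ∀ i, e i ≤ N) :
    CellDatum k (Subalgebra.centralizer k {jordan e (μ ∘ κ)}) where
  P := Fin m × Fin N
  M := Label e κ N
  C := cellBasis hμ hN
  ι := flipLinear e (μ ∘ κ)
  ι_mul a b := Subtype.ext (flip_mul _ _)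
  ι_ι a := Subtype.ext (flip_flip _)
  ι_C p i j := by
    rw [cellBasis_apply, cellBasis_apply]
    exact Subtype.ext (flip_shift i.2.2 j.2.2)
  r X p u i := entry (e := e) X u p.2 i p.2
  mul_C X p i j := by
    have hX := Subalgebra.mem_centralizer_singleton.1 X.2
    have hset : {x | ∃ q, q < p ∧ ∃ s t : Label e κ N q, x = cellBasis hμ hN ⟨q, s, t⟩} =
        cellBasis (κ := κ) hμ hN '' {q | q.1 < p} := by
      ext x
      constructor
      · rintro ⟨q, hq, s, t, rfl⟩
        exact ⟨⟨q, s, t⟩, hq, rfl⟩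
      · rintro ⟨⟨q, s, t⟩, hq, rfl⟩
        exact ⟨q, hq, s, t, rfl⟩
    rw [hset, Module.Basis.mem_span_image]
    intro q hq
    rw [Finset.mem_coe, Finsupp.mem_support_iff, cellBasis_repr] at hq
    by_contra hlt
    refine hq ?_
    -- A coordinate at a cell not below `p` vanishes: it belongs to another block column, or is
    -- cancelled by the sum (`s = s'`), or comes from below the diagonal of `X` (`s' < s`).
    simp only [cellBasis_apply, map_sub, map_sum, map_smul, coords_cell, Pi.sub_apply,
      Finset.sum_apply, Pi.smul_apply, coords_mul_cell, smul_eq_mul, Pi.single_apply]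
    obtain ⟨⟨c, s⟩, u, v⟩ := q
    obtain ⟨c', s'⟩ := p
    by_cases hv : (v : T) = j
    swap
    · rw [if_neg hv, Finset.sum_eq_zero, sub_zero]
      intro w _
      rw [if_neg, mul_zero]
      intro h
      refine hv ?_
      rw [Sigma.ext_iff] at h
      obtain ⟨h1, h2⟩ := h
      dsimp only at h1 h2
      cases h1
      exact congrArg (fun x => (x.2 : T)) (eq_of_heq h2)
    · obtain rfl : c = c' := v.2.1.symm.trans ((congrArg κ hv).trans j.2.1)
      rw [if_pos hv]
      obtain rfl | hs := eq_or_ne s s'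
      · obtain rfl : v = j := Subtype.ext hv
        rw [Finset.sum_eq_single u]
        · simp
        · intro w _ hw
          rw [if_neg, mul_zero]
          intro h
          simp only [Sigma.mk.injEq, heq_eq_eq, Prod.mk.injEq, true_and, and_true] at h
          exact hw h.symm
        · simp
      · have hs' : s' < s := by
          refine lt_of_le_of_ne ?_ hs.symm
          by_contra! hlt'
          exact hlt (Prod.mk_lt_mk_iff_right.2 hlt')
        rw [entry_eq_zero_of_lt hX hs', Finset.sum_eq_zero, sub_zero]
        intro w _
        rw [if_neg, mul_zero]
        intro h
        rw [Sigma.ext_iff] at h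
        exact hs (congrArg Prod.snd h.1)

end JordanMatrix

/-- The commutant of a Jordan matrix is cellular. -/
theorem isCellularAlgebra_centralizer_jordan {k : Type*} [Field k] {T : Type} [Fintype T]
    [DecidableEq T] (e : T → ℕ) (l : T → k) :
    IsCellularAlgebra k (Subalgebra.centralizer k {JordanMatrix.jordan e l}) := by
  -- Numbering the eigenvalues makes the poset finite and keeps it in `Type`.
  obtain ⟨m, ⟨φ⟩⟩ := Finite.exists_equiv_fin (Set.range l)
  let κ : T → Fin m := fun i => φ ⟨l i, i, rfl⟩
  let μ : Fin m → k := fun x => φ.symm x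
  have hl : l = μ ∘ κ := by ext i; simp [μ, κ]
  rw [hl]
  exact ⟨JordanMatrix.cellDatum (N := ∑ i, e i)
    (Subtype.val_injective.comp φ.symm.injective)
    fun i => Finset.single_le_sum (f := e) (fun _ _ => Nat.zero_le _) (Finset.mem_univ i)⟩

/-! ### The Jordan normal form -/

section JordanForm

open Polynomial

variable {k : Type*} [Field k]

/-- Multiplication by `X` on `k[X] / ((X - r) ^ e)` has a Jordan basis. -/
theorem exists_jordan_basis_quotient (r : k) (e : ℕ) :
    ∃ b : Module.Basis (Fin e) k (k[X] ⧸ Submodule.span k[X] {(X - C r) ^ e}),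
      ∀ a : Fin e, (X : k[X]) • b a = r • b a +
        if h : 0 < (a : ℕ) then b ⟨a - 1, by omega⟩ else 0 := by
  set I : Submodule k[X] k[X] := Submodule.span k[X] {(X - C r) ^ e} with hI
  -- The exponents decrease so that `X - C r` lowers the index, sending the vector of index `0` to
  -- `(X - C r) ^ e = 0`. Taylor expansion at `r` shows spanning, and a dimension count gives a
  -- basis.
  let w : Fin e → k[X] ⧸ I := fun a => Submodule.Quotient.mk ((X - C r) ^ (e - 1 - a))
  have hw : ⊤ ≤ Submodule.span k (Set.range w) := by
    rintro x -
    obtain ⟨p, rfl⟩ := Submodule.Quotient.mk_surjective I x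
    have hp : p = ∑ i ∈ (taylor r p).support, (taylor r p).coeff i • (X - C r) ^ i := by
      conv_lhs => rw [← sum_taylor_eq p r]
      simp [Polynomial.sum_def, smul_eq_C_mul]
    have hp' : (Submodule.Quotient.mk p : k[X] ⧸ I) = ∑ i ∈ (taylor r p).support,
        (taylor r p).coeff i • (Submodule.Quotient.mk ((X - C r) ^ i) : k[X] ⧸ I) := by
      conv_lhs => rw [hp]
      exact map_sum (I.mkQ.restrictScalars k) _ _
    rw [hp']
    refine Submodule.sum_mem _ fun i _ => Submodule.smul_mem _ _ ?_
    by_cases hi : i < e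
    · refine Submodule.subset_span ⟨⟨e - 1 - i, by omega⟩, ?_⟩
      simp only [w]
      congr 2
      omega
    · rw [(Submodule.Quotient.mk_eq_zero I).2]
      · exact Submodule.zero_mem _
      · exact Ideal.mem_span_singleton.2 (pow_dvd_pow _ (by omega))
  have hmonic : ((X - C r) ^ e).Monic := (monic_X_sub_C r).pow e
  have hrank : Fintype.card (Fin e) = Module.finrank k (k[X] ⧸ I) := by
    rw [Fintype.card_fin]
    refine Eq.trans ?_ (finrank_quotient_span_eq_natDegree (f := (X - C r) ^ e)).symm
    simp
  refine ⟨basisOfTopLeSpanOfCardEqFinrank w hw hrank, fun a => ?_⟩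
  simp only [coe_basisOfTopLeSpanOfCardEqFinrank]
  have h1 : (X : k[X]) • w a = r • w a + Submodule.Quotient.mk ((X - C r) ^ (e - 1 - a + 1)) := by
    simp only [w, ← Submodule.Quotient.mk_smul, ← Submodule.Quotient.mk_add]
    congr 1
    rw [smul_eq_mul, smul_eq_C_mul, pow_succ]
    ring
  rw [h1]
  congr 1
  split_ifs with h
  · simp only [w]
    congr 2
    omega
  · exact (Submodule.Quotient.mk_eq_zero I).2
      (Ideal.mem_span_singleton.2 (pow_dvd_pow _ (by omega)))

/-- **Jordan normal form** of an endomorphism over an algebraically closed field. -/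
theorem exists_jordan_basis [IsAlgClosed k] {V : Type*} [AddCommGroup V] [Module k V]
    [FiniteDimensional k V] (φ : Module.End k V) :
    ∃ (n : ℕ) (e : Fin n → ℕ) (l : Fin n → k) (b : Module.Basis (Σ j, Fin (e j)) k V),
      ∀ j (a : Fin (e j)), φ (b ⟨j, a⟩) = l j • b ⟨j, a⟩ +
        if h : 0 < (a : ℕ) then b ⟨j, a - 1, by omega⟩ else 0 := by
  classical
  -- The structure theorem over `k[X]`, with `X` acting as `φ`; each irreducible `p i` is then
  -- associated to a linear polynomial.
  obtain ⟨ι, _, p, hp, e, ⟨Φ⟩⟩ := Module.equiv_directSum_of_isTorsion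
    (Module.AEval.isTorsion_of_finiteDimensional k V φ)
  have hroot (i : ι) : ∃ r : k, Submodule.span k[X] {p i ^ e i} =
      Submodule.span k[X] {(X - C r) ^ e i} := by
    obtain ⟨r, hr⟩ := IsAlgClosed.exists_root (p i)
      (IsAlgClosed.degree_eq_one_of_irreducible k (hp i) ▸ one_ne_zero)
    refine ⟨r, Ideal.span_singleton_eq_span_singleton.2 (Associated.pow_pow ?_)⟩
    exact ((irreducible_X_sub_C r).associated_of_dvd (hp i) (dvd_iff_isRoot.2 hr)).symm
  choose r hr using hroot
  let n := Fintype.card ι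
  let σ : Fin n ≃ ι := (Fintype.equivFin ι).symm
  let Ψ : Module.AEval' φ ≃ₗ[k[X]]
      (∀ j : Fin n, k[X] ⧸ Submodule.span k[X] {(X - C (r (σ j))) ^ e (σ j)}) :=
    Φ ≪≫ₗ DirectSum.linearEquivFunOnFintype k[X] ι _ ≪≫ₗ
      (LinearEquiv.piCongrLeft k[X] (fun i => k[X] ⧸ Submodule.span k[X] {p i ^ e i}) σ).symm ≪≫ₗ
      LinearEquiv.piCongrRight fun j => Submodule.quotEquivOfEq _ _ (hr (σ j))
  choose b hb using fun j : Fin n => exists_jordan_basis_quotient (r (σ j)) (e (σ j))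
  let B : Module.Basis (Σ j : Fin n, Fin (e (σ j))) k V :=
    (Pi.basis b).map ((Ψ.restrictScalars k).symm ≪≫ₗ (Module.AEval'.of φ).symm)
  have hB (j : Fin n) (a : Fin (e (σ j))) :
      B ⟨j, a⟩ = (Module.AEval'.of φ).symm (Ψ.symm (Pi.single j (b j a))) := by
    simp only [B, Module.Basis.map_apply, Pi.basis_apply]
    rfl
  refine ⟨n, fun j => e (σ j), fun j => r (σ j), B, fun j a => ?_⟩
  have h1 : φ (B ⟨j, a⟩) =
      (Module.AEval'.of φ).symm (Ψ.symm (Pi.single j ((X : k[X]) • b j a))) := by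
    have hs := (LinearMap.single k[X]
      (fun j => k[X] ⧸ Submodule.span k[X] {(X - C (r (σ j))) ^ e (σ j)}) j).map_smul (X : k[X]) (b j a)
    simp only [LinearMap.coe_single] at hs
    rw [hB, hs, map_smul]
    exact (Module.AEval'.of_symm_X_smul φ _).symm
  have h2 (x) : (Module.AEval'.of φ).symm (Ψ.symm (Pi.single j (r (σ j) • x))) =
      r (σ j) • (Module.AEval'.of φ).symm (Ψ.symm (Pi.single j x)) := by
    have hs := (LinearMap.single k
      (fun j => k[X] ⧸ Submodule.span k[X] {(X - C (r (σ j))) ^ e (σ j)}) j).map_smul (r (σ j)) x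
    simp only [LinearMap.coe_single] at hs
    rw [hs, ← map_smul]
    congr 1
    exact map_smul (Ψ.restrictScalars k).symm _ _
  rw [h1, hb, Pi.single_add, map_add, map_add, h2, hB]
  congr 1
  split_ifs
  · rw [hB]
  · simp

/-- Every square matrix over an algebraically closed field is similar to a Jordan matrix. -/
theorem exists_algEquiv_jordan [IsAlgClosed k] {d : ℕ} (c : Matrix (Fin d) (Fin d) k) :
    ∃ (n : ℕ) (e : Fin n → ℕ) (l : Fin n → k)
      (φ : Matrix (Fin d) (Fin d) k ≃ₐ[k] Matrix (Σ j, Fin (e j)) (Σ j, Fin (e j)) k),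
      φ c = JordanMatrix.jordan e l := by
  obtain ⟨n, e, l, b, hb⟩ := exists_jordan_basis (Matrix.toLinAlgEquiv' c)
  refine ⟨n, e, l, Matrix.toLinAlgEquiv'.trans (LinearMap.toMatrixAlgEquiv b), ?_⟩
  ext x ⟨j, a⟩
  rw [AlgEquiv.trans_apply, LinearMap.toMatrixAlgEquiv_apply, hb, map_add, map_smul,
    Module.Basis.repr_self, Finsupp.add_apply, Finsupp.smul_apply, JordanMatrix.jordan,
    Matrix.add_apply, Matrix.of_apply, Matrix.diagonal_apply, Finsupp.single_apply]
  congr 1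
  · by_cases h : x = ⟨j, a⟩
    · subst h
      simp
    · simp [h, Ne.symm h]
  · obtain ⟨i, a'⟩ := x
    split_ifs with h1 h2 h2
    · obtain ⟨rfl, h2⟩ := h2
      dsimp only at h2
      obtain ⟨a, ha⟩ := a
      subst h2
      rw [Module.Basis.repr_self, Finsupp.single_apply, if_pos]
      rfl
    · rw [Module.Basis.repr_self, Finsupp.single_apply, if_neg]
      intro h
      refine h2 ?_
      rw [Sigma.mk.injEq] at h
      obtain ⟨rfl, h⟩ := h
      rw [← eq_of_heq h]
      exact ⟨rfl, by simp; omega⟩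
    · dsimp only at h2
      omega
    · simp

/-- The centralizer of a matrix over an algebraically closed field is cellular. -/
theorem isCellularAlgebra_centralizer_matrix [IsAlgClosed k] {d : ℕ}
    (c : Matrix (Fin d) (Fin d) k) : IsCellularAlgebra k (Subalgebra.centralizer k {c}) := by
  obtain ⟨n, e, l, φ, hφ⟩ := exists_algEquiv_jordan c
  refine IsCellularAlgebra.congr ?_ (Subalgebra.centralizerCongr φ c).symm
  rw [hφ]
  exact isCellularAlgebra_centralizer_jordan e l

end JordanForm

/-! ### The three properties for group algebras -/

theorem corollary1p3 {G k : Type*} [Group G] [Finite G] [Field k] [IsAlgClosed k]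
    (hG : ¬ ringChar k ∣ Nat.card G) (c : MonoidAlgebra k G) :
    IsCellularAlgebra k (Subalgebra.centralizer k {c}) ∧
      RingExtension.IsFrobenius (Subalgebra.centralizer k {c}).toSubring ∧
      RingExtension.IsSeparable (Subalgebra.centralizer k {c}).toSubring := by
  have hcard : (Nat.card G : k) ≠ 0 := fun h => hG ((ringChar.spec k _).1 h)
  -- The instance behind Maschke's theorem, which makes the group algebra semisimple.
  have : NeZero (Nat.card G : k) := ⟨hcard⟩
  obtain ⟨n, d, hd, ⟨φ⟩⟩ :=
    IsSemisimpleRing.exists_algEquiv_pi_matrix_of_isAlgClosed k (MonoidAlgebra k G)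
  refine ⟨?_, ?_, RingExtension.isSeparable_monoidAlgebra hcard _⟩
  · exact ((IsCellularAlgebra.pi fun i => isCellularAlgebra_centralizer_matrix (φ c i)).congr
      (Subalgebra.centralizerPi (φ c))).congr (Subalgebra.centralizerCongr φ c).symm
  · have F (i : Fin n) : FrobeniusSystem _ (φ c i) :=
      (nonempty_frobeniusSystem_matrix (φ c i)).some
    exact (FrobeniusSystem.congr φ.toRingEquiv (c := c) (FrobeniusSystem.pi F)).isFrobenius _
      fun a => Subalgebra.mem_centralizer_singleton (R := k)
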